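/- **Theorem (Asymptotic consistency of the distributionally robust risk-constrained program).** Setting. Let $\Xi\subseteq\mathbb{R}^m$, let $d$ be a complete metric on $\Xi$ inducing its usual (subspace) topology, and let $\mathbb{P}$ be a Borel probability measure on $\Xi$. Let $X\subseteq\mathbb{R}^n$ be closed and convex, $c\in\mathbb{R}^n$, $\alpha\in(0,1)$, and $F:\mathbb{R}^n\times\Xi\to\mathbb{R}$. For a random variable $Y$ with law determined by $\mathbb{P}$ put $\mathrm{CVaR}^{\mathbb{P}}_\alpha(Y)=\inf_{t\in\mathbb{R}}\{\alpha^{-1}\mathbb{E}_{\mathbb{P}}[(Y+t)_+]-t\}$. The risk-constrained program (RCP) is $$\min_{x\in X} c^\top x\quad\text{s.t.}\quad \mathrm{CVaR}^{\mathbb{P}}_\alpha(F(x,\xi))\le 0 .$$ For Borel probability measures $\mu,\nu$ on $\Xi$, let $W_1(\mu,\nu)=\inf_\gamma\int d(\xi,\omega)\,\gamma(d\xi,d\omega)\in[0,\infty]$ over all $\gamma$ on $\Xi\times\Xi$ with marginals $\mu,\nu$. Given samples $\widehat\xi_1,\dots,\widehat\xi_N\in\Xi$, let $\widehat{\mathbb{P}}_N=\frac1N\sum_{i=1}^N\delta_{\widehat\xi_i}$,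 and let $\mathcal{M}^\theta_N$ be the set of Borel probability measures $\mathbb{Q}$ on $\Xi$ with finite first moment (with respect to $d$) and $W_1(\mathbb{Q},\widehat{\mathbb{P}}_N)\le\theta$. The distributionally robust program (DRRCP) with radius $\theta$ is $$\min_{x\in X} c^\top x\quad\text{s.t.}\quad \sup_{\mathbb{Q}\in\mathcal{M}^\theta_N}\inf_{t\in\mathbb{R}}\mathbb{E}_{\mathbb{Q}}[(F(x,\xi)+t)_+-t\alpha]\le 0 .$$ Optimal values are infima in $[-\infty,+\infty]$ (equal to $+\infty$ if there is no feasible point); an optimizer is a feasible point attaining the minimum. Assumptions. 1. $F$ is continuous; $x\mapsto F(x,\xi)$ is convex on $X$ for every $\xi\in\Xi$; $\xi\mapsto F(x,\xi)$ is bounded on $\Xi$ for every $x\in X$; and there is $L>0$ with $|F(x,\xi)-F(x,\xi')|\le L\|\xi-\xi'\|$ for all $x\in X$, $\xi,\xi'\in\Xi$. 2. $\beta_N\in(0,1)$ and $\epsilon_N>0$ ($N\ge1$) satisfy $\sum_N\beta_N<\infty$, $\epsilon_N\to0$, and $\mathbb{P}^N\big(W_1(\mathbb{P},\widehat{\mathbb{P}}_N)\le\epsilon_N\big)\ge1-\beta_N$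 for every $N\ge1$. 3. The feasible set of the RCP has nonempty interior in $\mathbb{R}^n$ and contains a strictly feasible point, i.e. some $x\in X$ with $\mathrm{CVaR}^{\mathbb{P}}_\alpha(F(x,\xi))<0$. 4. There is a compact set $\mathcal{Y}\subseteq X$ that contains all optimizers of the RCP and, for all sufficiently large $N$ and every choice of samples $\widehat\xi_1,\dots,\widehat\xi_N\in\Xi$, all optimizers of the DRRCP with radius $\epsilon_N$. Let $J$ be the optimal value of the RCP and $J_N$ that of the DRRCP with radius $\epsilon_N$ built from the first $N$ terms of a sequence $(\widehat\xi_i)_{i\ge1}$ of independent samples from $\mathbb{P}$. Then, $\mathbb{P}^\infty$-almost surely: (i) $J\le J_N$ for all sufficiently large $N$; (ii) $J_N\to J$ as $N\to\infty$; (iii) if $x_N$ is an optimizer of the DRRCP with radius $\epsilon_N$ for all sufficiently large $N$, then every accumulation point of $(x_N)$ is an optimizer of the RCP. -/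

import Mathlib

open MeasureTheory Filter Topology
open scoped ENNReal

/-- `d` is a complete metric on the set `Ξ ⊆ ℝᵐ` that induces the usual (subspace) topology. -/
structure IsCompleteMetricOn {m : ℕ} (Ξ : Set (EuclideanSpace ℝ (Fin m))) (d : Ξ → Ξ → ℝ) :
    Prop where
  eq_zero_iff : ∀ ξ ω, d ξ ω = 0 ↔ ξ = ω
  symm : ∀ ξ ω, d ξ ω = d ω ξ
  triangle : ∀ ξ ω η, d ξ η ≤ d ξ ω + d ω η
  isOpen_iff : ∀ s : Set Ξ, IsOpen s ↔ ∀ ξ ∈ s, ∃ r > 0, ∀ ω, d ξ ω < r → ω ∈ s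
  complete : ∀ u : ℕ → Ξ, (∀ r > 0, ∃ K, ∀ i ≥ K, ∀ j ≥ K, d (u i) (u j) < r) →
    ∃ ξ, Tendsto (fun i => d (u i) ξ) atTop (𝓝 0)

section Wasserstein

/-- `μ` has a finite first moment with respect to `d`. -/
def HasFiniteFirstMoment {S : Type*} [MeasurableSpace S] (d : S → S → ℝ) (μ : Measure S) : Prop :=
  ∃ ξ₀, ∫⁻ ξ, ENNReal.ofReal (d ξ ξ₀) ∂μ < ∞

/-- The measures on `S × S` with marginals `μ` and `ν`. -/
def couplings {S : Type*} [MeasurableSpace S] (μ ν : Measure S) : Set (Measure (S × S)) :=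
  {γ | γ.map Prod.fst = μ ∧ γ.map Prod.snd = ν}

/-- The `1`-Wasserstein distance for the metric `d`, as an extended nonnegative real. -/
noncomputable def wasserstein1 {S : Type*} [MeasurableSpace S] (d : S → S → ℝ)
    (μ ν : Measure S) : ℝ≥0∞ :=
  ⨅ γ ∈ couplings μ ν, ∫⁻ p, ENNReal.ofReal (d p.1 p.2) ∂γ

/-- The empirical distribution `(1/N) ∑ᵢ δ_{s i}`. -/
noncomputable def empiricalMeasure {S : Type*} [MeasurableSpace S] {N : ℕ} (s : Fin N → S) :
    Measure S :=
  (N : ℝ≥0∞)⁻¹ • ∑ i, Measure.dirac (s i)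

/-- The ambiguity set: probability measures with finite first moment whose Wasserstein distance
to the empirical distribution of the sample `s` is at most `θ`. -/
def ambiguitySet {S : Type*} [MeasurableSpace S] (d : S → S → ℝ) (θ : ℝ) {N : ℕ}
    (s : Fin N → S) : Set (Measure S) :=
  {μ | IsProbabilityMeasure μ ∧ HasFiniteFirstMoment d μ ∧
    wasserstein1 d μ (empiricalMeasure s) ≤ ENNReal.ofReal θ}

end Wasserstein

section Programs

/-- The conditional value-at-risk of `Y` at level `α`,
`inf_t (α⁻¹ E[(Y + t)₊] - t)`, as an extended real. -/
noncomputable def cvar {S : Type*} [MeasurableSpace S] (μ : Measure S) (α : ℝ) (Y : S → ℝ) :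
    EReal :=
  ⨅ t : ℝ, ((α⁻¹ * (∫ ξ, max (Y ξ + t) 0 ∂μ) - t : ℝ) : EReal)

/-- The feasible set of the risk-constrained program (RCP). -/
def rcpFeasible {E S : Type*} [MeasurableSpace S] (X : Set E) (F : E → S → ℝ) (α : ℝ)
    (P : Measure S) : Set E :=
  {x | x ∈ X ∧ cvar P α (F x) ≤ 0}

/-- The feasible set of the distributionally robust risk-constrained program (DRRCP) with
radius `θ` and sample `s`. -/
def drrcpFeasible {E S : Type*} [MeasurableSpace S] (d : S → S → ℝ) (X : Set E)
    (F : E → S → ℝ) (α θ : ℝ) {N : ℕ} (s : Fin N → S) : Set E :=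
  {x | x ∈ X ∧
    (⨆ Q ∈ ambiguitySet d θ s,
      ⨅ t : ℝ, ((∫ ξ, (max (F x ξ + t) 0 - t * α) ∂Q : ℝ) : EReal)) ≤ 0}

/-- The optimal value of `min cᵀx` over `x ∈ A`, an extended real (`⊤` if `A` is empty). -/
noncomputable def optimalValue {n : ℕ} (c : EuclideanSpace ℝ (Fin n))
    (A : Set (EuclideanSpace ℝ (Fin n))) : EReal :=
  ⨅ x ∈ A, ((inner ℝ c x : ℝ) : EReal)

/-- The set of optimizers of `min cᵀx` over `x ∈ A`. -/
def optimizers {n : ℕ} (c : EuclideanSpace ℝ (Fin n))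
    (A : Set (EuclideanSpace ℝ (Fin n))) : Set (EuclideanSpace ℝ (Fin n)) :=
  {x | x ∈ A ∧ ∀ y ∈ A, (inner ℝ c x : ℝ) ≤ inner ℝ c y}

end Programs

/-- The sequences `ε`, `β` provide finite-sample guarantees for `P`: for every `N ≥ 1`,
`P^N (W₁(P, P̂_N) ≤ ε_N) ≥ 1 - β_N`, where `β` is summable and `ε` tends to zero. -/
structure FiniteSampleGuarantee {S : Type*} [MeasurableSpace S] (d : S → S → ℝ) (P : Measure S)
    (ε β : ℕ → ℝ) : Prop where
  β_mem : ∀ N ≥ 1, β N ∈ Set.Ioo (0 : ℝ) 1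
  ε_pos : ∀ N ≥ 1, 0 < ε N
  summable_β : Summable β
  tendsto_ε : Tendsto ε atTop (𝓝 0)
  guarantee : ∀ N ≥ 1, ENNReal.ofReal (1 - β N) ≤ Measure.pi (fun _ : Fin N => P)
    {s | wasserstein1 d P (empiricalMeasure s) ≤ ENNReal.ofReal (ε N)}

/-- The first `N` terms of a sequence of samples. -/
def firstSamples {S : Type*} (ω : ℕ → S) (N : ℕ) : Fin N → S := fun i => ω i

/-!
Everything happens on the event that `W₁(P, P̂_N) ≤ ε_N` for all large `N`, which is almost sure by
Borel–Cantelli (`FiniteSampleGuarantee.ae_eventually`). The events involved have to be measurable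
for this; they are closed, because moving the sample points changes `W₁(P, P̂_N)` by at most the
average displacement (`wasserstein1_empiricalMeasure_le`). On this event the argument is
deterministic.

* For large `N` the measure `P` lies in the ambiguity set, so every feasible point of the robust
  program is feasible for the risk-constrained program (`drrcpFeasible_subset_rcpFeasible`), and
  `J ≤ J_N`.
* A point `x` with `CVaR(F(x, ξ)) < 0` is robustly feasible for large `N`
  (`eventually_mem_drrcpFeasible`). Indeed, choose a level `t` at which the objective for `P` is
  negative. The bounded continuous function `(F(x, ξ) + t)₊` lies below a function that is
  Lipschitz for `d` and has almost the same integral for `P` (`lipschitzEnvelope`), and integrals of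
  Lipschitz functions over the ambiguity set converge uniformly, by the easy half of Kantorovich
  duality (`abs_integral_sub_le_of_wasserstein1_le`). The approximation is necessary because
  `F x` need not be Lipschitz, or even uniformly continuous, for `d`.
* Convexity of the conditional value-at-risk makes every feasible point a limit of strictly feasible
  points (`cvar_convexCombination_neg`), which gives `limsup J_N ≤ J`, hence `J_N → J`.
* The feasible set of the risk-constrained program is closed (`isClosed_rcpFeasible`, by Fatou's
  lemma). A cluster point of robust optimizers is therefore feasible, and its value is
  `lim J_N = J`.
-/

/-! ### The metric on the sample space -/

lemma completeSpace_of_forall_dist {S : Type*} [M : MetricSpace S]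
    (h : ∀ u : ℕ → S, (∀ r > 0, ∃ K, ∀ i ≥ K, ∀ j ≥ K, dist (u i) (u j) < r) →
      ∃ ξ, Tendsto (fun i => dist (u i) ξ) atTop (𝓝 0)) : CompleteSpace S :=
  Metric.complete_of_cauchySeq_tendsto fun u hu =>
    (h u (Metric.cauchySeq_iff.1 hu)).imp fun _ => tendsto_iff_dist_tendsto_zero.2

namespace IsCompleteMetricOn

variable {m : ℕ} {Ξ : Set (EuclideanSpace ℝ (Fin m))} {d : Ξ → Ξ → ℝ}

lemma self_eq_zero (hd : IsCompleteMetricOn Ξ d) (ξ : Ξ) : d ξ ξ = 0 :=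
  (hd.eq_zero_iff ξ ξ).2 rfl

lemma nonneg (hd : IsCompleteMetricOn Ξ d) (ξ η : Ξ) : 0 ≤ d ξ η := by
  have h1 := hd.triangle ξ η ξ
  rw [hd.self_eq_zero, hd.symm η ξ] at h1
  linarith

/-- The metric space structure given by `d`, with the subspace topology as its topology. -/
@[reducible]
noncomputable def metricSpace (hd : IsCompleteMetricOn Ξ d) : MetricSpace Ξ :=
  MetricSpace.ofDistTopology d hd.self_eq_zero hd.symm hd.triangle hd.isOpen_iff
    (fun ξ η => (hd.eq_zero_iff ξ η).1)

lemma polishSpace (hd : IsCompleteMetricOn Ξ d) : PolishSpace Ξ := by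
  have : TopologicalSpace.IsCompletelyMetrizableSpace Ξ :=
    ⟨hd.metricSpace, rfl, completeSpace_of_forall_dist (M := hd.metricSpace) hd.complete⟩
  exact {}

lemma continuous_uncurry (hd : IsCompleteMetricOn Ξ d) :
    Continuous (fun p : Ξ × Ξ => d p.1 p.2) := by
  let M := hd.metricSpace
  exact @continuous_dist Ξ M.toPseudoMetricSpace

lemma eventually_lt (hd : IsCompleteMetricOn Ξ d) (ξ : Ξ) {r : ℝ} (hr : 0 < r) :
    ∀ᶠ η in 𝓝 ξ, d ξ η < r := by
  have h : Continuous (fun η => d ξ η) :=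
    hd.continuous_uncurry.comp (continuous_const.prodMk continuous_id)
  exact h.continuousAt.eventually_lt continuousAt_const (by rwa [hd.self_eq_zero])

lemma exists_ball_subset (hd : IsCompleteMetricOn Ξ d) {ξ : Ξ} {U : Set Ξ} (hU : U ∈ 𝓝 ξ) :
    ∃ r > 0, ∀ η, d ξ η < r → η ∈ U := by
  obtain ⟨V, hVU, hV, hξ⟩ := mem_nhds_iff.1 hU
  obtain ⟨r, hr, h⟩ := (hd.isOpen_iff V).1 hV ξ hξ
  exact ⟨r, hr, fun η hη => hVU (h η hη)⟩

lemma continuous_of_sub_le (hd : IsCompleteMetricOn Ξ d) {f : Ξ → ℝ} {k : ℝ} (hk : 0 ≤ k)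
    (hf : ∀ ξ η, f ξ - f η ≤ k * d ξ η) : Continuous f := by
  refine continuous_iff_continuousAt.2 fun ξ => Metric.tendsto_nhds.2 fun e he => ?_
  filter_upwards [hd.eventually_lt ξ (show 0 < e / (k + 1) by positivity)] with η hη
  have h1 := hf ξ η
  have h2 := hf η ξ
  rw [hd.symm η ξ] at h2
  have h3 : k * d ξ η < e := by
    have := (lt_div_iff₀ (by positivity)).1 hη
    nlinarith [hd.nonneg ξ η]
  rw [Real.dist_eq, abs_lt]
  constructor <;> linarith

end IsCompleteMetricOn

/-! ### Couplings and the Wasserstein distance to an empirical measure -/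

section Coupling

variable {m : ℕ} {Ξ : Set (EuclideanSpace ℝ (Fin m))} {d : Ξ → Ξ → ℝ}

lemma isProbabilityMeasure_empiricalMeasure {S : Type*} [MeasurableSpace S] {N : ℕ} (hN : N ≠ 0)
    (s : Fin N → S) : IsProbabilityMeasure (empiricalMeasure s) := by
  refine ⟨?_⟩
  simp only [empiricalMeasure, Measure.smul_apply, Measure.finsetSum_apply, measure_univ,
    Finset.sum_const, Finset.card_univ, Fintype.card_fin, smul_eq_mul, nsmul_eq_mul, mul_one]
  exact ENNReal.inv_mul_cancel (by simpa using hN) (by simp)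

lemma lintegral_empiricalMeasure {S : Type*} [MeasurableSpace S] {N : ℕ}
    (s : Fin N → S) {f : S → ℝ≥0∞} (hf : Measurable f) :
    ∫⁻ ξ, f ξ ∂(empiricalMeasure s) = (N : ℝ≥0∞)⁻¹ * ∑ i, f (s i) := by
  simp [empiricalMeasure, lintegral_dirac' _ hf]

lemma isProbabilityMeasure_of_mem_couplings {S : Type*} [MeasurableSpace S] {μ ν : Measure S}
    [IsProbabilityMeasure μ] {γ : Measure (S × S)} (hγ : γ ∈ couplings μ ν) :
    IsProbabilityMeasure γ := by
  refine ⟨?_⟩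
  rw [← measure_univ (μ := μ), ← hγ.1, Measure.map_apply measurable_fst .univ, Set.preimage_univ]

/-- Moving the atoms of the empirical measure from `s` to `s'` changes the Wasserstein distance by
at most the average displacement: disintegrate a coupling along the atoms `s i`, and attach the
conditional law at `s i` to `s' i`. -/
lemma wasserstein1_empiricalMeasure_le (hd : IsCompleteMetricOn Ξ d) {P : Measure Ξ}
    [IsProbabilityMeasure P] {N : ℕ} (hN : N ≠ 0) (s s' : Fin N → Ξ) :
    wasserstein1 d P (empiricalMeasure s') ≤ wasserstein1 d P (empiricalMeasure s) +
      (N : ℝ≥0∞)⁻¹ * ∑ i, ENNReal.ofReal (d (s i) (s' i)) := by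
  have := hd.polishSpace
  have hne : Nonempty Ξ := ⟨s ⟨0, Nat.pos_of_ne_zero hN⟩⟩
  have hdm : Measurable (fun p : Ξ × Ξ => ENNReal.ofReal (d p.1 p.2)) :=
    hd.continuous_uncurry.measurable.ennreal_ofReal
  have hsec : ∀ η, Measurable (fun ξ => ENNReal.ofReal (d ξ η)) := fun η =>
    hdm.comp (measurable_id.prodMk measurable_const)
  have := isProbabilityMeasure_empiricalMeasure hN s
  conv_rhs => rw [wasserstein1]
  simp only [ENNReal.iInf_add]
  refine le_iInf₂ fun γ hγ => ?_
  have := isProbabilityMeasure_of_mem_couplings hγ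
  set γs : Measure (Ξ × Ξ) := γ.map Prod.swap with hγs
  have hfin : IsProbabilityMeasure γs := Measure.isProbabilityMeasure_map (by fun_prop)
  have hfst : γs.fst = empiricalMeasure s := by
    rw [Measure.fst, hγs, Measure.map_map measurable_fst measurable_swap]
    exact hγ.2
  have hsnd : γs.snd = P := by
    rw [Measure.snd, hγs, Measure.map_map measurable_snd measurable_swap]
    exact hγ.1
  set κ := γs.condKernel
  have hdis : (empiricalMeasure s).compProd κ = γs := by rw [← hfst]; exact γs.disintegrate κ
  have hint : ∀ f : Ξ × Ξ → ℝ≥0∞, Measurable f →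
      ∫⁻ p, f p ∂γs = (N : ℝ≥0∞)⁻¹ * ∑ i, ∫⁻ ξ, f (s i, ξ) ∂(κ (s i)) := by
    intro f hf
    rw [← hdis, Measure.lintegral_compProd hf, lintegral_empiricalMeasure]
    exact hf.lintegral_kernel_prod_right'
  -- the glued coupling
  let γ' : Measure (Ξ × Ξ) := (N : ℝ≥0∞)⁻¹ • ∑ i, (κ (s i)).prod (Measure.dirac (s' i))
  have hint' : ∀ f : Ξ × Ξ → ℝ≥0∞, Measurable f →
      ∫⁻ p, f p ∂γ' = (N : ℝ≥0∞)⁻¹ * ∑ i, ∫⁻ ξ, f (ξ, s' i) ∂(κ (s i)) := by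
    intro f hf
    simp only [γ', lintegral_smul_measure, lintegral_finsetSum_measure, smul_eq_mul]
    congr 1
    refine Finset.sum_congr rfl fun i _ => ?_
    rw [lintegral_prod _ hf.aemeasurable]
    refine lintegral_congr fun ξ => ?_
    exact lintegral_dirac' _ (hf.comp (measurable_const.prodMk measurable_id))
  have hmem : γ' ∈ couplings P (empiricalMeasure s') := by
    constructor
    · ext B hB
      have hg : Measurable (B.indicator (1 : Ξ → ℝ≥0∞)) := measurable_one.indicator hB
      rw [← lintegral_indicator_one hB, lintegral_map hg measurable_fst,
        hint' (fun p => B.indicator 1 p.1) (hg.comp measurable_fst), ← hsnd,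
        ← lintegral_indicator_one hB, Measure.snd, lintegral_map hg measurable_snd,
        hint (fun p => B.indicator 1 p.2) (hg.comp measurable_snd)]
    · ext B hB
      have hg : Measurable (B.indicator (1 : Ξ → ℝ≥0∞)) := measurable_one.indicator hB
      rw [← lintegral_indicator_one hB, lintegral_map hg measurable_snd,
        hint' (fun p => B.indicator 1 p.2) (hg.comp measurable_snd),
        ← lintegral_indicator_one hB, lintegral_empiricalMeasure _ hg]
      simp
  refine (iInf₂_le γ' hmem).trans ?_
  have hγint : ∫⁻ p, ENNReal.ofReal (d p.1 p.2) ∂γ =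
      ∫⁻ p, ENNReal.ofReal (d p.2 p.1) ∂γs := by
    exact (lintegral_map (hdm.comp measurable_swap) measurable_swap).symm
  rw [hγint, hint' _ hdm, hint (fun p => ENNReal.ofReal (d p.2 p.1)) (hdm.comp measurable_swap),
    ← mul_add, ← Finset.sum_add_distrib]
  gcongr with i
  calc ∫⁻ ξ, ENNReal.ofReal (d ξ (s' i)) ∂(κ (s i))
      ≤ ∫⁻ ξ, (ENNReal.ofReal (d ξ (s i)) + ENNReal.ofReal (d (s i) (s' i))) ∂(κ (s i)) := by
        refine lintegral_mono fun ξ => ?_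
        rw [← ENNReal.ofReal_add (hd.nonneg _ _) (hd.nonneg _ _)]
        exact ENNReal.ofReal_le_ofReal (hd.triangle _ _ _)
    _ = _ := by
        rw [lintegral_add_left (hsec _)]
        simp

lemma isClosed_setOf_wasserstein1_le (hd : IsCompleteMetricOn Ξ d) (P : Measure Ξ)
    [IsProbabilityMeasure P] {N : ℕ} (hN : N ≠ 0) (r : ℝ≥0∞) :
    IsClosed {s : Fin N → Ξ | wasserstein1 d P (empiricalMeasure s) ≤ r} := by
  refine IsSeqClosed.isClosed fun u s hu hus => ?_
  have hlim : Tendsto (fun k => r + (N : ℝ≥0∞)⁻¹ * ∑ i, ENNReal.ofReal (d (u k i) (s i)))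
      atTop (𝓝 (r + (N : ℝ≥0∞)⁻¹ * ∑ _i : Fin N, 0)) := by
    refine tendsto_const_nhds.add (ENNReal.Tendsto.const_mul (tendsto_finsetSum _ fun i _ => ?_)
      (Or.inr (by simpa using hN)))
    have h : Continuous (fun ξ => ENNReal.ofReal (d ξ (s i))) := ENNReal.continuous_ofReal.comp
      (hd.continuous_uncurry.comp (continuous_id.prodMk continuous_const))
    simpa [hd.self_eq_zero, Function.comp_def] using
      (h.tendsto (s i)).comp (tendsto_pi_nhds.1 hus i)
  rw [Finset.sum_const_zero, mul_zero, add_zero] at hlim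
  refine ge_of_tendsto' hlim fun k => (wasserstein1_empiricalMeasure_le hd hN (u k) s).trans ?_
  gcongr
  exact hu k

lemma exists_coupling_le {S : Type*} [MeasurableSpace S] {d : S → S → ℝ} {μ ν : Measure S}
    {θ e : ℝ} (hθ : 0 ≤ θ) (he : 0 < e)
    (h : wasserstein1 d μ ν ≤ ENNReal.ofReal θ) :
    ∃ γ ∈ couplings μ ν, ∫⁻ p, ENNReal.ofReal (d p.1 p.2) ∂γ ≤ ENNReal.ofReal (θ + e) := by
  have h1 : wasserstein1 d μ ν < ENNReal.ofReal (θ + e) :=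
    h.trans_lt ((ENNReal.ofReal_lt_ofReal_iff (by linarith)).2 (by linarith))
  obtain ⟨γ, hγ, hlt⟩ := by simpa only [wasserstein1, iInf_lt_iff] using h1
  exact ⟨γ, hγ, hlt.le⟩

/-- The easy half of Kantorovich duality, for bounded functions. -/
lemma abs_integral_sub_le_of_wasserstein1_le (hd : IsCompleteMetricOn Ξ d) {μ ν : Measure Ξ}
    [IsProbabilityMeasure μ] [IsProbabilityMeasure ν] {θ k C : ℝ} (hθ : 0 ≤ θ) (hk : 0 ≤ k)
    (h : wasserstein1 d μ ν ≤ ENNReal.ofReal θ) {f : Ξ → ℝ}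
    (hf : ∀ ξ η, f ξ - f η ≤ k * d ξ η) (hC : ∀ ξ, |f ξ| ≤ C) :
    |∫ ξ, f ξ ∂μ - ∫ ξ, f ξ ∂ν| ≤ k * θ := by
  have hfc := (hd.continuous_of_sub_le hk hf).measurable
  have key : ∀ e > 0, |∫ ξ, f ξ ∂μ - ∫ ξ, f ξ ∂ν| ≤ k * (θ + e) := by
    intro e he
    obtain ⟨γ, hγ, hle⟩ := exists_coupling_le hθ he h
    have := isProbabilityMeasure_of_mem_couplings hγ
    have hdm := hd.continuous_uncurry.measurable
    have hdint : Integrable (fun p : Ξ × Ξ => d p.1 p.2) γ := by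
      refine ⟨hdm.aestronglyMeasurable, ?_⟩
      rw [hasFiniteIntegral_iff_ofReal (ae_of_all γ fun p : Ξ × Ξ => hd.nonneg p.1 p.2)]
      exact hle.trans_lt ENNReal.ofReal_lt_top
    have hd_le : ∫ p, d p.1 p.2 ∂γ ≤ θ + e := by
      rw [integral_eq_lintegral_of_nonneg_ae (ae_of_all γ fun p : Ξ × Ξ => hd.nonneg p.1 p.2)
        hdm.aestronglyMeasurable]
      exact ENNReal.toReal_le_of_le_ofReal (by positivity) hle
    have hi1 : Integrable (fun p : Ξ × Ξ => f p.1) γ :=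
      .of_bound (hfc.comp measurable_fst).aestronglyMeasurable C (ae_of_all _ fun p => hC p.1)
    have hi2 : Integrable (fun p : Ξ × Ξ => f p.2) γ :=
      .of_bound (hfc.comp measurable_snd).aestronglyMeasurable C (ae_of_all _ fun p => hC p.2)
    rw [← hγ.1, ← hγ.2, integral_map measurable_fst.aemeasurable hfc.aestronglyMeasurable,
      integral_map measurable_snd.aemeasurable hfc.aestronglyMeasurable, ← integral_sub hi1 hi2]
    calc |∫ p, (f p.1 - f p.2) ∂γ| ≤ ∫ p, |f p.1 - f p.2| ∂γ := abs_integral_le_integral_abs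
      _ ≤ ∫ p, k * d p.1 p.2 ∂γ := by
        refine integral_mono (hi1.sub hi2).abs (hdint.const_mul k) fun p => ?_
        have h1 := hf p.1 p.2
        have h2 := hf p.2 p.1
        rw [hd.symm p.2 p.1] at h2
        exact abs_le.2 ⟨by linarith, h1⟩
      _ ≤ k * (θ + e) := by
        rw [integral_const_mul]
        gcongr
  refine ge_of_tendsto (f := fun e => k * (θ + e)) (x := 𝓝[>] (0 : ℝ)) ?_
    (eventually_mem_nhdsWithin.mono key)
  have : Tendsto (fun e : ℝ => k * (θ + e)) (𝓝 0) (𝓝 (k * (θ + 0))) :=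
    Continuous.tendsto (by fun_prop) 0
  rw [add_zero] at this
  exact this.mono_left nhdsWithin_le_nhds

lemma hasFiniteFirstMoment_of_wasserstein1_le (hd : IsCompleteMetricOn Ξ d) {P : Measure Ξ}
    [IsProbabilityMeasure P] {N : ℕ} (hN : N ≠ 0) {s : Fin N → Ξ} {θ : ℝ} (hθ : 0 ≤ θ)
    (h : wasserstein1 d P (empiricalMeasure s) ≤ ENNReal.ofReal θ) :
    HasFiniteFirstMoment d P := by
  obtain ⟨γ, hγ, hle⟩ := exists_coupling_le hθ one_pos h
  have := isProbabilityMeasure_of_mem_couplings hγ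
  let ξ₀ := s ⟨0, Nat.pos_of_ne_zero hN⟩
  have hdm : Measurable (fun p : Ξ × Ξ => ENNReal.ofReal (d p.1 p.2)) :=
    hd.continuous_uncurry.measurable.ennreal_ofReal
  have hsec : Measurable (fun ξ => ENNReal.ofReal (d ξ ξ₀)) :=
    hdm.comp (measurable_id.prodMk measurable_const)
  refine ⟨ξ₀, ?_⟩
  have h2 : ∫⁻ p, ENNReal.ofReal (d p.2 ξ₀) ∂γ < ∞ := by
    rw [← lintegral_map (g := Prod.snd) hsec measurable_snd, hγ.2, lintegral_empiricalMeasure _ hsec]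
    refine ENNReal.mul_lt_top (by simpa [pos_iff_ne_zero] using hN) ?_
    exact ENNReal.sum_lt_top.2 fun i _ => ENNReal.ofReal_lt_top
  calc ∫⁻ ξ, ENNReal.ofReal (d ξ ξ₀) ∂P = ∫⁻ p, ENNReal.ofReal (d p.1 ξ₀) ∂γ := by
        rw [← lintegral_map (g := Prod.fst) hsec measurable_fst, hγ.1]
    _ ≤ ∫⁻ p, (ENNReal.ofReal (d p.1 p.2) + ENNReal.ofReal (d p.2 ξ₀)) ∂γ := by
        refine lintegral_mono fun p => ?_
        rw [← ENNReal.ofReal_add (hd.nonneg _ _) (hd.nonneg _ _)]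
        exact ENNReal.ofReal_le_ofReal (hd.triangle _ _ _)
    _ < ∞ := by
        rw [lintegral_add_left hdm]
        exact ENNReal.add_lt_top.2 ⟨hle.trans_lt ENNReal.ofReal_lt_top, h2⟩

end Coupling

/-! ### Almost sure validity of the finite-sample guarantee -/

lemma measurePreserving_firstSamples {S : Type*} [MeasurableSpace S] (P : Measure S)
    [IsProbabilityMeasure P] (N : ℕ) :
    MeasurePreserving (fun ω : ℕ → S => firstSamples ω N)
      (Measure.infinitePi fun _ : ℕ => P) (Measure.pi fun _ : Fin N => P) := by
  have hmeas : Measurable (fun ω : ℕ → S => firstSamples ω N) := by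
    unfold firstSamples; fun_prop
  refine ⟨hmeas, (Measure.pi_eq fun t ht => ?_).symm⟩
  classical
  have hpre : (fun ω : ℕ → S => firstSamples ω N) ⁻¹' Set.univ.pi t =
      Set.pi (Finset.range N) (fun i => if h : i < N then t ⟨i, h⟩ else Set.univ) := by
    ext ω
    simp only [Set.mem_preimage, Set.mem_pi, Set.mem_univ, forall_true_left, firstSamples,
      Finset.coe_range, Set.mem_Iio]
    constructor
    · intro h i hi
      simpa [hi] using h ⟨i, hi⟩
    · intro h i
      simpa using h i i.2
  rw [Measure.map_apply hmeas (.univ_pi ht), hpre, Measure.infinitePi_pi, Finset.prod_range]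
  · simp
  · intro i hi
    simp only [Finset.mem_range] at hi
    simpa [hi] using ht ⟨i, hi⟩

/-- Borel–Cantelli: the events `W₁(P, P̂_N) > ε_N` have summable probabilities. They are measurable
because `W₁(P, P̂_N)` is a lower semicontinuous function of the sample. -/
lemma FiniteSampleGuarantee.ae_eventually {m : ℕ} {Ξ : Set (EuclideanSpace ℝ (Fin m))}
    {d : Ξ → Ξ → ℝ} (hd : IsCompleteMetricOn Ξ d) {P : Measure Ξ} [IsProbabilityMeasure P]
    {ε β : ℕ → ℝ} (h : FiniteSampleGuarantee d P ε β) :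
    ∀ᵐ ω ∂(Measure.infinitePi fun _ : ℕ => P), ∀ᶠ N in atTop,
      wasserstein1 d P (empiricalMeasure (firstSamples ω N)) ≤ ENNReal.ofReal (ε N) := by
  let A : (N : ℕ) → Set (Fin N → Ξ) := fun N =>
    {s | wasserstein1 d P (empiricalMeasure s) ≤ ENNReal.ofReal (ε N)}
  have hbound : ∀ N, (Measure.infinitePi fun _ : ℕ => P)
      ((fun ω => firstSamples ω (N + 1)) ⁻¹' (A (N + 1))ᶜ) ≤ ENNReal.ofReal (β (N + 1)) := by
    intro N
    have hmeas : MeasurableSet (A (N + 1)) :=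
      (isClosed_setOf_wasserstein1_le hd P N.succ_ne_zero _).measurableSet
    rw [(measurePreserving_firstSamples P (N + 1)).measure_preimage hmeas.compl.nullMeasurableSet,
      prob_compl_eq_one_sub hmeas, tsub_le_iff_right]
    have hβ := h.β_mem (N + 1) (by omega)
    calc (1 : ℝ≥0∞) = ENNReal.ofReal (β (N + 1)) + ENNReal.ofReal (1 - β (N + 1)) := by
          rw [← ENNReal.ofReal_add hβ.1.le (by linarith [hβ.2])]; simp
      _ ≤ _ := by gcongr; exact h.guarantee (N + 1) (by omega)
  have hsum : ∑' N, (Measure.infinitePi fun _ : ℕ => P)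
      ((fun ω => firstSamples ω (N + 1)) ⁻¹' (A (N + 1))ᶜ) ≠ ∞ := by
    refine ne_top_of_le_ne_top ?_ (ENNReal.tsum_le_tsum hbound)
    exact ((summable_nat_add_iff 1).2 h.summable_β).tsum_ofReal_ne_top
  filter_upwards [ae_eventually_notMem hsum] with ω hω
  refine (eventually_atTop.1 hω).elim fun K hK => eventually_atTop.2 ⟨K + 1, fun N hN => ?_⟩
  obtain ⟨M, rfl⟩ : ∃ M, N = M + 1 := ⟨N - 1, by omega⟩
  have := hK M (by omega)
  simpa [A] using this

/-! ### Approximation of bounded continuous functions by Lipschitz functions -/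

section Envelope

variable {m : ℕ} {Ξ : Set (EuclideanSpace ℝ (Fin m))} {d : Ξ → Ξ → ℝ}

/-- The least `k`-Lipschitz function (with respect to `d`) above a bounded function `g`, for
`k ≥ 0`. -/
noncomputable def lipschitzEnvelope {S : Type*} (d : S → S → ℝ) (g : S → ℝ) (k : ℝ) (ξ : S) : ℝ :=
  ⨆ η, (g η - k * d ξ η)

variable {g : Ξ → ℝ} {C k : ℝ}

lemma sub_le_of_abs_le (hd : IsCompleteMetricOn Ξ d) (hC : ∀ ξ, |g ξ| ≤ C) (hk : 0 ≤ k)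
    (ξ η : Ξ) : g η - k * d ξ η ≤ C := by
  have h1 := (abs_le.1 (hC η)).2
  have h2 := mul_nonneg hk (hd.nonneg ξ η)
  linarith

lemma le_lipschitzEnvelope (hd : IsCompleteMetricOn Ξ d) (hC : ∀ ξ, |g ξ| ≤ C) (hk : 0 ≤ k)
    (ξ η : Ξ) : g η - k * d ξ η ≤ lipschitzEnvelope d g k ξ :=
  le_ciSup (f := fun η => g η - k * d ξ η)
    ⟨C, Set.forall_mem_range.2 (sub_le_of_abs_le hd hC hk ξ)⟩ η

lemma self_le_lipschitzEnvelope (hd : IsCompleteMetricOn Ξ d) (hC : ∀ ξ, |g ξ| ≤ C)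
    (hk : 0 ≤ k) (ξ : Ξ) : g ξ ≤ lipschitzEnvelope d g k ξ := by
  simpa [hd.self_eq_zero] using le_lipschitzEnvelope hd hC hk ξ ξ

lemma abs_lipschitzEnvelope_le (hd : IsCompleteMetricOn Ξ d) (hC : ∀ ξ, |g ξ| ≤ C)
    (hk : 0 ≤ k) (ξ : Ξ) : |lipschitzEnvelope d g k ξ| ≤ C := by
  have : Nonempty Ξ := ⟨ξ⟩
  refine abs_le.2 ⟨?_, ciSup_le (sub_le_of_abs_le hd hC hk ξ)⟩
  exact (abs_le.1 (hC ξ)).1.trans (self_le_lipschitzEnvelope hd hC hk ξ)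

lemma lipschitzEnvelope_sub_le (hd : IsCompleteMetricOn Ξ d) (hC : ∀ ξ, |g ξ| ≤ C)
    (hk : 0 ≤ k) (ξ η : Ξ) :
    lipschitzEnvelope d g k ξ - lipschitzEnvelope d g k η ≤ k * d ξ η := by
  have : Nonempty Ξ := ⟨ξ⟩
  rw [sub_le_iff_le_add]
  refine ciSup_le fun ζ => ?_
  have h1 := le_lipschitzEnvelope hd hC hk η ζ
  have h2 := hd.triangle η ξ ζ
  rw [hd.symm η ξ] at h2
  nlinarith

lemma tendsto_lipschitzEnvelope (hd : IsCompleteMetricOn Ξ d) (hC : ∀ ξ, |g ξ| ≤ C)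
    (hg : Continuous g) (ξ : Ξ) :
    Tendsto (fun k : ℕ => lipschitzEnvelope d g k ξ) atTop (𝓝 (g ξ)) := by
  have : Nonempty Ξ := ⟨ξ⟩
  refine Metric.tendsto_atTop.2 fun e he => ?_
  obtain ⟨r, hr, hball⟩ := hd.exists_ball_subset
    ((hg.tendsto ξ).eventually (gt_mem_nhds (show g ξ < g ξ + e / 2 by linarith)))
  obtain ⟨K, hK⟩ := exists_nat_ge (2 * C / r)
  refine ⟨K, fun k hk => ?_⟩
  have hle : lipschitzEnvelope d g k ξ ≤ g ξ + e / 2 := by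
    refine ciSup_le fun η => ?_
    have hdη := hd.nonneg ξ η
    by_cases h : d ξ η < r
    · have h1 : g η < g ξ + e / 2 := hball η h
      have h2 : 0 ≤ (k : ℝ) * d ξ η := by positivity
      linarith
    -- away from `ξ` the penalty outweighs the oscillation `2 * C` of `g`
    · have h1 := (abs_le.1 (hC η)).2
      have h2 := (abs_le.1 (hC ξ)).1
      have h3 : 2 * C ≤ k * d ξ η := calc
        2 * C ≤ K * r := (div_le_iff₀ hr).1 hK
        _ ≤ k * d ξ η := by
          have : (K : ℝ) ≤ k := by exact_mod_cast hk
          have := not_lt.1 h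
          gcongr
      linarith
  have hge := self_le_lipschitzEnvelope hd hC (Nat.cast_nonneg k) ξ
  rw [Real.dist_eq, abs_lt]
  constructor <;> linarith

lemma exists_lipschitzEnvelope_integral_lt (hd : IsCompleteMetricOn Ξ d) (hC : ∀ ξ, |g ξ| ≤ C)
    (hg : Continuous g) (P : Measure Ξ) [IsProbabilityMeasure P] {e : ℝ} (he : 0 < e) :
    ∃ k : ℕ, ∫ ξ, lipschitzEnvelope d g k ξ ∂P < ∫ ξ, g ξ ∂P + e := by
  have hlim : Tendsto (fun k : ℕ => ∫ ξ, lipschitzEnvelope d g k ξ ∂P) atTop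
      (𝓝 (∫ ξ, g ξ ∂P)) := by
    refine tendsto_integral_of_dominated_convergence (fun _ => C) (fun k => ?_)
      (integrable_const C) (fun k => ae_of_all P fun ξ => ?_)
      (ae_of_all P fun ξ => tendsto_lipschitzEnvelope hd hC hg ξ)
    · exact (hd.continuous_of_sub_le k.cast_nonneg
        (lipschitzEnvelope_sub_le hd hC k.cast_nonneg)).aestronglyMeasurable
    · exact abs_lipschitzEnvelope_le hd hC k.cast_nonneg ξ
  exact (hlim.eventually (gt_mem_nhds (by linarith))).exists

/-- Integrals of a bounded continuous function over the ambiguity sets are asymptotically at most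
the integral for `P`, uniformly over the ambiguity set: `Q`, the empirical measure and `P` are
successively `ε N`-close, so that the integrals of an envelope differ by at most `2 * k * ε N`. -/
lemma eventually_forall_ambiguitySet_integral_lt (hd : IsCompleteMetricOn Ξ d) {P : Measure Ξ}
    [IsProbabilityMeasure P] {ε : ℕ → ℝ} (hε : ∀ N ≥ 1, 0 < ε N) (hε0 : Tendsto ε atTop (𝓝 0))
    {s : (N : ℕ) → Fin N → Ξ}
    (hs : ∀ᶠ N in atTop, wasserstein1 d P (empiricalMeasure (s N)) ≤ ENNReal.ofReal (ε N))
    (hg : Continuous g) (hC : ∀ ξ, |g ξ| ≤ C) {e : ℝ} (he : 0 < e) :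
    ∀ᶠ N in atTop, ∀ Q ∈ ambiguitySet d (ε N) (s N), ∫ ξ, g ξ ∂Q < ∫ ξ, g ξ ∂P + e := by
  obtain ⟨k, hk⟩ := exists_lipschitzEnvelope_integral_lt hd hC hg P (half_pos he)
  have hk0 : (0 : ℝ) ≤ k := k.cast_nonneg
  have hlip := lipschitzEnvelope_sub_le hd hC hk0
  have hbd := abs_lipschitzEnvelope_le hd hC hk0
  have hlim : Tendsto (fun N => 2 * (k * ε N)) atTop (𝓝 (2 * (k * 0))) :=
    (hε0.const_mul _).const_mul _
  filter_upwards [hs, eventually_ge_atTop 1,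
    hlim.eventually (gt_mem_nhds (show 2 * ((k : ℝ) * 0) < e / 2 by linarith))]
    with N hN hN1 hNε Q hQ
  obtain ⟨hQp, -, hQN⟩ := hQ
  have := isProbabilityMeasure_empiricalMeasure (by omega : N ≠ 0) (s N)
  have h1 := abs_le.1
    (abs_integral_sub_le_of_wasserstein1_le hd (hε N hN1).le hk0 hQN hlip hbd)
  have h2 := abs_le.1
    (abs_integral_sub_le_of_wasserstein1_le hd (hε N hN1).le hk0 hN hlip hbd)
  have h3 : ∫ ξ, g ξ ∂Q ≤ ∫ ξ, lipschitzEnvelope d g k ξ ∂Q := by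
    refine integral_mono ?_ ?_ (self_le_lipschitzEnvelope hd hC hk0)
    · exact .of_bound hg.aestronglyMeasurable C (ae_of_all Q hC)
    · exact .of_bound (hd.continuous_of_sub_le hk0 hlip).aestronglyMeasurable C (ae_of_all Q hbd)
  linarith [h1.2, h2.1]

end Envelope

/-! ### The risk constraints -/

section Constraints

lemma EReal.iInf_coe_nonpos_iff {ι : Type*} {f : ι → ℝ} :
    (⨅ t, (f t : EReal)) ≤ 0 ↔ ∀ e > 0, ∃ t, f t < e := by
  constructor
  · intro h e he
    obtain ⟨t, ht⟩ := iInf_lt_iff.1 (h.trans_lt (EReal.coe_pos.2 he))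
    exact ⟨t, EReal.coe_lt_coe_iff.1 ht⟩
  · intro h
    refine le_of_forall_gt fun b hb => ?_
    obtain ⟨e, he, heb⟩ := EReal.lt_iff_exists_real_btwn.1 hb
    obtain ⟨t, ht⟩ := h e (EReal.coe_pos.1 he)
    exact (iInf_le _ t).trans_lt ((EReal.coe_lt_coe_iff.2 ht).trans heb)

variable {S : Type*} [MeasurableSpace S] {α : ℝ}

lemma cvar_nonpos_iff (hα : 0 < α) (P : Measure S) (Y : S → ℝ) :
    cvar P α Y ≤ 0 ↔ ∀ e > 0, ∃ t, ∫ ξ, max (Y ξ + t) 0 ∂P < α * (t + e) := by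
  simp only [cvar, EReal.iInf_coe_nonpos_iff, sub_lt_iff_lt_add', inv_mul_lt_iff₀ hα]

lemma cvar_neg_iff (hα : 0 < α) (P : Measure S) (Y : S → ℝ) :
    cvar P α Y < 0 ↔ ∃ t, ∫ ξ, max (Y ξ + t) 0 ∂P < α * t := by
  simp only [cvar, iInf_lt_iff, EReal.coe_neg', sub_neg, inv_mul_lt_iff₀ hα]

variable [TopologicalSpace S] [BorelSpace S]

lemma abs_max_add_zero_le {y t C : ℝ} (h : |y| ≤ C) : |max (y + t) 0| ≤ C + |t| := by
  rw [abs_of_nonneg (le_max_right _ _)]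
  have h1 := le_abs_self t
  have h2 := le_abs_self y
  exact max_le (by linarith) (by linarith [abs_nonneg y, abs_nonneg t])

lemma integrable_max_add_zero (Q : Measure S) [IsFiniteMeasure Q] {Y : S → ℝ}
    (hY : Continuous Y) {C : ℝ} (hC : ∀ ξ, |Y ξ| ≤ C) (t : ℝ) :
    Integrable (fun ξ => max (Y ξ + t) 0) Q := by
  have h : Continuous (fun ξ => max (Y ξ + t) 0) := by fun_prop
  exact .of_bound h.measurable.aestronglyMeasurable (C + |t|)
    (ae_of_all Q fun ξ => abs_max_add_zero_le (hC ξ))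

lemma integral_max_add_zero_sub (Q : Measure S) [IsProbabilityMeasure Q] {Y : S → ℝ}
    (hY : Continuous Y) {C : ℝ} (hC : ∀ ξ, |Y ξ| ≤ C) (t : ℝ) :
    ∫ ξ, (max (Y ξ + t) 0 - t * α) ∂Q = ∫ ξ, max (Y ξ + t) 0 ∂Q - t * α := by
  rw [integral_sub (integrable_max_add_zero Q hY hC t) (integrable_const _)]
  simp

variable {E : Type*} {X : Set E} {F : E → S → ℝ} {P : Measure S} [IsProbabilityMeasure P]

/-- If `P` itself lies in the ambiguity set, the robust constraint is the stronger one. -/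
lemma drrcpFeasible_subset_rcpFeasible {d : S → S → ℝ} (hα : 0 < α)
    (hF : ∀ x, Continuous (F x)) (hFbdd : ∀ x ∈ X, ∃ C : ℝ, ∀ ξ, |F x ξ| ≤ C)
    {θ : ℝ} {N : ℕ} {s : Fin N → S} (hP : P ∈ ambiguitySet d θ s) :
    drrcpFeasible d X F α θ s ⊆ rcpFeasible X F α P := by
  rintro x ⟨hx, h⟩
  obtain ⟨C, hC⟩ := hFbdd x hx
  refine ⟨hx, (cvar_nonpos_iff hα P _).2 fun e he => ?_⟩
  obtain ⟨t, ht⟩ := EReal.iInf_coe_nonpos_iff.1 (iSup₂_le_iff.1 h P hP) (α * e) (by positivity)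
  rw [integral_max_add_zero_sub P (hF x) hC] at ht
  exact ⟨t, by linarith⟩

/-- The part of a segment near a strictly feasible point is strictly feasible, because the
conditional value-at-risk is convex. -/
lemma cvar_convexCombination_neg [AddCommGroup E] [Module ℝ E] (hα : 0 < α)
    (hF : ∀ x, Continuous (F x)) (hFconvex : ∀ ξ, ConvexOn ℝ X (fun x => F x ξ))
    (hFbdd : ∀ x ∈ X, ∃ C : ℝ, ∀ ξ, |F x ξ| ≤ C) {x y : E} (hx : x ∈ X)
    (hxP : cvar P α (F x) < 0) (hy : y ∈ rcpFeasible X F α P) {a : ℝ} (ha : 0 < a) (ha1 : a ≤ 1) :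
    cvar P α (F (a • x + (1 - a) • y)) < 0 := by
  obtain ⟨hyX, hyP⟩ := hy
  obtain ⟨Cx, hCx⟩ := hFbdd x hx
  obtain ⟨Cy, hCy⟩ := hFbdd y hyX
  rcases eq_or_lt_of_le ha1 with rfl | ha1
  · simpa using hxP
  obtain ⟨t, ht⟩ := (cvar_neg_iff hα P _).1 hxP
  set δ := α * t - ∫ ξ, max (F x ξ + t) 0 ∂P with hδ
  have hδ0 : 0 < δ := by linarith
  have hb : 0 < 1 - a := by linarith
  -- the violation `e` allowed at `y` is compensated by the slack `δ` at `x`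
  obtain ⟨u, hu⟩ := (cvar_nonpos_iff hα P _).1 hyP (a * δ / (α * (1 - a))) (by positivity)
  have hu' : (1 - a) * ∫ ξ, max (F y ξ + u) 0 ∂P < (1 - a) * (α * u) + a * δ := by
    have := mul_lt_mul_of_pos_left hu hb
    have h2 : (1 - a) * (α * (u + a * δ / (α * (1 - a)))) = (1 - a) * (α * u) + a * δ := by
      field_simp
    rwa [h2] at this
  refine (cvar_neg_iff hα P _).2 ⟨a * t + (1 - a) * u, ?_⟩
  have hix := integrable_max_add_zero P (hF x) hCx t
  have hiy := integrable_max_add_zero P (hF y) hCy u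
  have hle : ∫ ξ, max (F (a • x + (1 - a) • y) ξ + (a * t + (1 - a) * u)) 0 ∂P ≤
      ∫ ξ, (a * max (F x ξ + t) 0 + (1 - a) * max (F y ξ + u) 0) ∂P := by
    refine integral_mono_of_nonneg (ae_of_all P fun ξ => le_max_right _ _)
      ((hix.const_mul a).add (hiy.const_mul (1 - a))) (ae_of_all P fun ξ => ?_)
    have h1 := (hFconvex ξ).2 hx hyX ha.le hb.le (by ring)
    simp only [smul_eq_mul] at h1
    have h2 := mul_le_mul_of_nonneg_left (le_max_left (F x ξ + t) 0) ha.le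
    have h3 := mul_le_mul_of_nonneg_left (le_max_left (F y ξ + u) 0) hb.le
    have h4 := mul_nonneg ha.le (le_max_right (F x ξ + t) 0)
    have h5 := mul_nonneg hb.le (le_max_right (F y ξ + u) 0)
    exact max_le (by linarith) (by linarith)
  rw [integral_add (hix.const_mul a) (hiy.const_mul (1 - a)), integral_const_mul,
    integral_const_mul] at hle
  have hδ' : a * δ = a * (α * t) - a * ∫ ξ, max (F x ξ + t) 0 ∂P := by rw [hδ]; ring
  linarith

end Constraints

/-- A strictly feasible point of the risk-constrained program is eventually feasible for the robust
programs: a level `t` that is strictly good for `P` serves all measures of the ambiguity set. -/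
lemma eventually_mem_drrcpFeasible {m : ℕ} {Ξ : Set (EuclideanSpace ℝ (Fin m))} {d : Ξ → Ξ → ℝ}
    (hd : IsCompleteMetricOn Ξ d) {E : Type*} {X : Set E} {F : E → Ξ → ℝ} {P : Measure Ξ}
    [IsProbabilityMeasure P] {α : ℝ} (hα : 0 < α)
    (hF : ∀ x, Continuous (F x)) (hFbdd : ∀ x ∈ X, ∃ C : ℝ, ∀ ξ, |F x ξ| ≤ C)
    {ε : ℕ → ℝ} (hε : ∀ N ≥ 1, 0 < ε N) (hε0 : Tendsto ε atTop (𝓝 0))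
    {s : (N : ℕ) → Fin N → Ξ}
    (hs : ∀ᶠ N in atTop, wasserstein1 d P (empiricalMeasure (s N)) ≤ ENNReal.ofReal (ε N))
    {x : E} (hx : x ∈ X) (hxP : cvar P α (F x) < 0) :
    ∀ᶠ N in atTop, x ∈ drrcpFeasible d X F α (ε N) (s N) := by
  obtain ⟨C, hC⟩ := hFbdd x hx
  obtain ⟨t, ht⟩ := (cvar_neg_iff hα P _).1 hxP
  have hg : Continuous (fun ξ => max (F x ξ + t) 0) := by have := hF x; fun_prop
  filter_upwards [eventually_forall_ambiguitySet_integral_lt hd hε hε0 hs hg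
    (fun ξ => abs_max_add_zero_le (hC ξ)) (sub_pos.2 ht)] with N hN
  refine ⟨hx, iSup₂_le fun Q hQ => (iInf_le _ t).trans ?_⟩
  have := hQ.1
  rw [integral_max_add_zero_sub Q (hF x) hC, ← EReal.coe_zero, EReal.coe_le_coe_iff]
  linarith [hN Q hQ]

/-- The feasible set of the risk-constrained program is closed. For a convergent sequence of
feasible points, levels `t k` that are almost optimal are bounded: below since `CVaR` is at least
`-t k`, above since `α < 1` and the costs are bounded below off an event of small probability.
Fatou's lemma then passes the constraint to the limit. -/
lemma isClosed_rcpFeasible {E S : Type*} [TopologicalSpace E] [SequentialSpace E]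
    [TopologicalSpace S] [MeasurableSpace S] [BorelSpace S] {X : Set E} (hX : IsClosed X)
    {F : E → S → ℝ} (hF : ∀ x, Continuous (F x)) (hF' : ∀ ξ, Continuous fun x => F x ξ)
    (hFbdd : ∀ x ∈ X, ∃ C : ℝ, ∀ ξ, |F x ξ| ≤ C) {α : ℝ} (hα : α ∈ Set.Ioo (0 : ℝ) 1)
    (P : Measure S) [IsProbabilityMeasure P] : IsClosed (rcpFeasible X F α P) := by
  refine IsSeqClosed.isClosed fun x xbar hx hlim => ?_
  have hxbar : xbar ∈ X := hX.mem_of_tendsto hlim (Eventually.of_forall fun k => (hx k).1)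
  have hpt : ∀ ξ, Tendsto (fun k => F (x k) ξ) atTop (𝓝 (F xbar ξ)) := fun ξ =>
    ((hF' ξ).tendsto xbar).comp hlim
  have hint : ∀ k t, Integrable (fun ξ => max (F (x k) ξ + t) 0) P := fun k t => by
    obtain ⟨C, hC⟩ := hFbdd _ (hx k).1
    exact integrable_max_add_zero P (hF _) hC t
  have hlevel : ∀ k : ℕ, ∃ t, ∫ ξ, max (F (x k) ξ + t) 0 ∂P < α * (t + 1 / ((k : ℝ) + 1)) :=
    fun k => (cvar_nonpos_iff hα.1 P _).1 (hx k).2 _ (by positivity)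
  choose t ht using hlevel
  have hinv : ∀ k : ℕ, 1 / ((k : ℝ) + 1) ≤ 1 := fun k => by
    rw [div_le_one (by positivity)]
    have : (0 : ℝ) ≤ k := k.cast_nonneg
    linarith
  have ht' : ∀ k, ∫ ξ, max (F (x k) ξ + t k) 0 ∂P < α * (t k + 1) := fun k =>
    (ht k).trans_le (mul_le_mul_of_nonneg_left (by linarith [hinv k]) hα.1.le)
  have hlow : ∀ k, -1 ≤ t k := by
    intro k
    have h0 : 0 ≤ ∫ ξ, max (F (x k) ξ + t k) 0 ∂P := integral_nonneg fun ξ => le_max_right _ _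
    have := pos_of_mul_pos_right (h0.trans_lt (ht' k)) hα.1.le
    linarith
  -- the costs along the sequence are bounded below on an event of probability above `α`
  let A : ℕ → Set S := fun j => {ξ | ∀ k, -(j : ℝ) ≤ F (x k) ξ}
  have hAm : ∀ j, MeasurableSet (A j) := fun j => by
    simp only [A, Set.ofPred_forall]
    exact .iInter fun k => (isClosed_le continuous_const (hF (x k))).measurableSet
  have hAmono : Monotone A := fun i j hij ξ hξ k => by
    have h1 : (i : ℝ) ≤ j := by exact_mod_cast hij
    linarith [hξ k]
  have hAuniv : ⋃ j, A j = Set.univ := by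
    refine Set.eq_univ_of_forall fun ξ => Set.mem_iUnion.2 ?_
    obtain ⟨b, hb⟩ := (hpt ξ).bddBelow_range
    obtain ⟨j, hj⟩ := exists_nat_ge (-b)
    exact ⟨j, fun k => by linarith [hb (Set.mem_range_self k)]⟩
  obtain ⟨j, hj⟩ : ∃ j, α < P.real (A j) := by
    have h1 := tendsto_measure_iUnion_atTop (μ := P) hAmono
    rw [hAuniv, measure_univ] at h1
    have h2 := (ENNReal.tendsto_toReal ENNReal.one_ne_top).comp h1
    exact (h2.eventually (lt_mem_nhds (by simpa using hα.2))).exists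
  have hup : ∀ k, t k ≤ (α + P.real (A j) * j) / (P.real (A j) - α) := by
    intro k
    have h1 : P.real (A j) * (t k - j) ≤ ∫ ξ, max (F (x k) ξ + t k) 0 ∂P := by
      rw [← smul_eq_mul, ← integral_indicator_const _ (hAm j)]
      refine integral_mono ((integrable_const _).indicator (hAm j)) (hint k _) fun ξ => ?_
      by_cases hξ : ξ ∈ A j
      · rw [Set.indicator_of_mem hξ]
        exact (by linarith [hξ k] : t k - j ≤ F (x k) ξ + t k).trans (le_max_left _ _)
      · rw [Set.indicator_of_notMem hξ]
        exact le_max_right _ _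
    rw [le_div_iff₀ (by linarith)]
    linarith [ht' k]
  obtain ⟨tbar, -, φ, hφ, htφ⟩ := isCompact_Icc.tendsto_subseq fun k => ⟨hlow k, hup k⟩
  have hrhs : Tendsto (fun i => α * (t (φ i) + 1 / ((φ i : ℝ) + 1))) atTop (𝓝 (α * tbar)) := by
    have h1 : Tendsto (fun i => 1 / ((φ i : ℝ) + 1)) atTop (𝓝 0) :=
      tendsto_one_div_add_atTop_nhds_zero_nat.comp hφ.tendsto_atTop
    simpa using (htφ.add h1).const_mul α
  obtain ⟨C, hC⟩ := hFbdd xbar hxbar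
  have hibar := integrable_max_add_zero P (hF xbar) hC tbar
  have hconv : ∀ ξ, Tendsto (fun i => ENNReal.ofReal (max (F (x (φ i)) ξ + t (φ i)) 0)) atTop
      (𝓝 (ENNReal.ofReal (max (F xbar ξ + tbar) 0))) := fun ξ =>
    (ENNReal.continuous_ofReal.tendsto _).comp
      ((((hpt ξ).comp hφ.tendsto_atTop).add htφ).max tendsto_const_nhds)
  have hfatou : ENNReal.ofReal (∫ ξ, max (F xbar ξ + tbar) 0 ∂P) ≤ ENNReal.ofReal (α * tbar) := by
    rw [ofReal_integral_eq_lintegral_ofReal hibar (ae_of_all P fun ξ => le_max_right _ _)]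
    calc ∫⁻ ξ, ENNReal.ofReal (max (F xbar ξ + tbar) 0) ∂P
        = ∫⁻ ξ, liminf (fun i => ENNReal.ofReal (max (F (x (φ i)) ξ + t (φ i)) 0)) atTop ∂P :=
          lintegral_congr fun ξ => (hconv ξ).liminf_eq.symm
      _ ≤ liminf (fun i => ∫⁻ ξ, ENNReal.ofReal (max (F (x (φ i)) ξ + t (φ i)) 0) ∂P) atTop :=
          lintegral_liminf_le fun i => by
            have := (hF (x (φ i))).measurable
            fun_prop
      _ ≤ liminf (fun i => ENNReal.ofReal (α * (t (φ i) + 1 / ((φ i : ℝ) + 1)))) atTop := by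
          refine liminf_le_liminf (Eventually.of_forall fun i => ?_)
          rw [← ofReal_integral_eq_lintegral_ofReal (hint _ _)
            (ae_of_all P fun ξ => le_max_right _ _)]
          exact ENNReal.ofReal_le_ofReal (ht (φ i)).le
      _ = ENNReal.ofReal (α * tbar) :=
          ((ENNReal.continuous_ofReal.tendsto _).comp hrhs).liminf_eq
  have htbar : 0 ≤ α * tbar := ge_of_tendsto' hrhs fun i =>
    (integral_nonneg fun ξ => le_max_right _ _).trans (ht (φ i)).le
  have hle := (ENNReal.ofReal_le_ofReal_iff htbar).1 hfatou
  refine ⟨hxbar, (cvar_nonpos_iff hα.1 P _).2 fun e he => ⟨tbar, hle.trans_lt ?_⟩⟩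
  nlinarith [hα.1]

/-! ### Optimal values and optimizers -/

section Optimization

variable {n : ℕ} {c : EuclideanSpace ℝ (Fin n)} {A B : Set (EuclideanSpace ℝ (Fin n))}

lemma optimalValue_anti (h : A ⊆ B) : optimalValue c B ≤ optimalValue c A :=
  biInf_mono h

lemma optimalValue_le {x : EuclideanSpace ℝ (Fin n)} (hx : x ∈ A) :
    optimalValue c A ≤ ((inner ℝ c x : ℝ) : EReal) :=
  iInf₂_le x hx

lemma optimalValue_eq_of_mem_optimizers {x : EuclideanSpace ℝ (Fin n)} (hx : x ∈ optimizers c A) :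
    optimalValue c A = ((inner ℝ c x : ℝ) : EReal) :=
  le_antisymm (optimalValue_le hx.1) (le_iInf₂ fun y hy => EReal.coe_le_coe_iff.2 (hx.2 y hy))

lemma mem_optimizers_of_eq {x : EuclideanSpace ℝ (Fin n)} (hx : x ∈ A)
    (h : ((inner ℝ c x : ℝ) : EReal) = optimalValue c A) : x ∈ optimizers c A :=
  ⟨hx, fun _ hy => EReal.coe_le_coe_iff.1 (h.trans_le (optimalValue_le hy))⟩

/-- Shrinking feasible sets have convergent optimal values if every value above the limit is beaten
by a point that eventually remains feasible. -/
lemma tendsto_optimalValue {A : Set (EuclideanSpace ℝ (Fin n))}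
    {B : ℕ → Set (EuclideanSpace ℝ (Fin n))} (hBA : ∀ᶠ N in atTop, B N ⊆ A)
    (h : ∀ x ∈ A, ∀ b : ℝ, inner ℝ c x < b → ∃ y, inner ℝ c y < b ∧ ∀ᶠ N in atTop, y ∈ B N) :
    Tendsto (fun N => optimalValue c (B N)) atTop (𝓝 (optimalValue c A)) := by
  refine tendsto_order.2 ⟨fun a ha => ?_, fun b hb => ?_⟩
  · filter_upwards [hBA] with N hN
    exact ha.trans_le (optimalValue_anti hN)
  · obtain ⟨b', hb', hb'b⟩ := EReal.lt_iff_exists_real_btwn.1 hb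
    obtain ⟨x, hx, hxb⟩ := by simpa only [optimalValue, iInf_lt_iff] using hb'
    obtain ⟨y, hy, hyB⟩ := h x hx b' (EReal.coe_lt_coe_iff.1 hxb)
    filter_upwards [hyB] with N hN
    exact ((optimalValue_le hN).trans_lt (EReal.coe_lt_coe_iff.2 hy)).trans hb'b

/-- Cluster points of optimizers are optimizers, if the feasible sets lie in a closed set and the
optimal values converge to the one over this set. -/
lemma mem_optimizers_of_mapClusterPt {B : ℕ → Set (EuclideanSpace ℝ (Fin n))} (hA : IsClosed A)
    (hBA : ∀ᶠ N in atTop, B N ⊆ A)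
    (hlim : Tendsto (fun N => optimalValue c (B N)) atTop (𝓝 (optimalValue c A)))
    {x : ℕ → EuclideanSpace ℝ (Fin n)} (hx : ∀ᶠ N in atTop, x N ∈ optimizers c (B N))
    {xbar : EuclideanSpace ℝ (Fin n)} (hbar : MapClusterPt xbar atTop x) :
    xbar ∈ optimizers c A := by
  obtain ⟨φ, hφ, hφx⟩ := hbar.tendsto_subseq
  have hφ' := hφ.tendsto_atTop
  refine mem_optimizers_of_eq ?_ ?_
  · refine hA.mem_of_tendsto hφx ?_
    filter_upwards [hφ'.eventually hBA, hφ'.eventually hx] with i h1 h2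
    exact h1 h2.1
  · refine tendsto_nhds_unique ?_ (hlim.comp hφ')
    have h1 : Tendsto (fun i => ((inner ℝ c (x (φ i)) : ℝ) : EReal)) atTop
        (𝓝 ((inner ℝ c xbar : ℝ) : EReal)) :=
      (continuous_coe_real_ereal.tendsto _).comp (tendsto_const_nhds.inner hφx)
    refine h1.congr' ?_
    filter_upwards [hφ'.eventually hx] with i hi
    exact (optimalValue_eq_of_mem_optimizers hi).symm

end Optimization

/-! ### Asymptotic consistency -/

theorem mainTheorem1 {n m : ℕ}
    (Ξ : Set (EuclideanSpace ℝ (Fin m))) (d : Ξ → Ξ → ℝ) (hd : IsCompleteMetricOn Ξ d)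
    (X : Set (EuclideanSpace ℝ (Fin n))) (hXclosed : IsClosed X) (hXconvex : Convex ℝ X)
    (c : EuclideanSpace ℝ (Fin n)) (α : ℝ) (hα : α ∈ Set.Ioo (0 : ℝ) 1)
    (P : Measure Ξ) [IsProbabilityMeasure P]
    (F : EuclideanSpace ℝ (Fin n) → Ξ → ℝ)
    -- general assumptions on the constraint function
    (hFcont : Continuous (fun p : EuclideanSpace ℝ (Fin n) × Ξ => F p.1 p.2))
    (hFconvex : ∀ ξ, ConvexOn ℝ X (fun x => F x ξ))
    (hFbdd : ∀ x ∈ X, ∃ C : ℝ, ∀ ξ, |F x ξ| ≤ C)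
    (hFlip : ∃ L > 0, ∀ x ∈ X, ∀ ξ ξ' : Ξ,
      |F x ξ - F x ξ'| ≤ L * ‖(ξ : EuclideanSpace ℝ (Fin m)) - ξ'‖)
    -- finite-sample guarantees
    (ε β : ℕ → ℝ) (hguar : FiniteSampleGuarantee d P ε β)
    -- the feasible set has nonempty interior and contains a strictly feasible point
    (hint : (interior (rcpFeasible X F α P)).Nonempty)
    (hstrict : ∃ x ∈ X, cvar P α (F x) < 0)
    -- the optimizers lie in a compact set
    (Y : Set (EuclideanSpace ℝ (Fin n))) (hYcompact : IsCompact Y) (hYX : Y ⊆ X)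
    (hYrcp : optimizers c (rcpFeasible X F α P) ⊆ Y)
    (hYdrrcp : ∃ N₀ : ℕ, ∀ N ≥ N₀, ∀ s : Fin N → Ξ,
      optimizers c (drrcpFeasible d X F α (ε N) s) ⊆ Y) :
    ∀ᵐ ω ∂(Measure.infinitePi (fun _ : ℕ => P)),
      (∀ᶠ N in atTop, optimalValue c (rcpFeasible X F α P) ≤
        optimalValue c (drrcpFeasible d X F α (ε N) (firstSamples ω N))) ∧
      Tendsto (fun N => optimalValue c (drrcpFeasible d X F α (ε N) (firstSamples ω N)))
        atTop (𝓝 (optimalValue c (rcpFeasible X F α P))) ∧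
      (∀ x : ℕ → EuclideanSpace ℝ (Fin n),
        (∀ᶠ N in atTop, x N ∈ optimizers c (drrcpFeasible d X F α (ε N) (firstSamples ω N))) →
        ∀ xbar, MapClusterPt xbar atTop x → xbar ∈ optimizers c (rcpFeasible X F α P)) := by
  have hFc : ∀ x, Continuous (F x) := fun x => hFcont.comp (continuous_const.prodMk continuous_id)
  have hFc' : ∀ ξ, Continuous fun x => F x ξ := fun ξ =>
    hFcont.comp (continuous_id.prodMk continuous_const)
  filter_upwards [hguar.ae_eventually hd] with ω hω
  have hsub : ∀ᶠ N in atTop, drrcpFeasible d X F α (ε N) (firstSamples ω N) ⊆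
      rcpFeasible X F α P := by
    filter_upwards [hω, eventually_ge_atTop 1] with N hN hN1
    exact drrcpFeasible_subset_rcpFeasible hα.1 hFc hFbdd
      ⟨inferInstance, hasFiniteFirstMoment_of_wasserstein1_le hd (by omega)
        (hguar.ε_pos N hN1).le hN, hN⟩
  have hlim : Tendsto (fun N => optimalValue c (drrcpFeasible d X F α (ε N) (firstSamples ω N)))
      atTop (𝓝 (optimalValue c (rcpFeasible X F α P))) := by
    refine tendsto_optimalValue hsub fun y hy b hyb => ?_
    obtain ⟨x₀, hx₀, hx₀P⟩ := hstrict
    -- move from `y` slightly towards the strictly feasible point, keeping the value below `b`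
    have hcont : Continuous fun a : ℝ => (inner ℝ c (a • x₀ + (1 - a) • y) : ℝ) := by fun_prop
    have hnear : ∀ᶠ a in 𝓝[>] (0 : ℝ), (inner ℝ c (a • x₀ + (1 - a) • y) : ℝ) < b :=
      nhdsWithin_le_nhds ((hcont.tendsto 0).eventually (gt_mem_nhds (by simpa using hyb)))
    obtain ⟨a, hab, ha0, ha1⟩ :=
      (hnear.and (Ioc_mem_nhdsGT (zero_lt_one' ℝ))).exists
    exact ⟨_, hab, eventually_mem_drrcpFeasible hd hα.1 hFc hFbdd hguar.ε_pos hguar.tendsto_ε hω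
      (hXconvex hx₀ hy.1 ha0.le (sub_nonneg.2 ha1) (by ring))
      (cvar_convexCombination_neg hα.1 hFc hFconvex hFbdd hx₀ hx₀P hy ha0 ha1)⟩
  exact ⟨hsub.mono fun N hN => optimalValue_anti hN, hlim, fun x hx xbar hbar =>
    mem_optimizers_of_mapClusterPt (isClosed_rcpFeasible hXclosed hFc hFc' hFbdd hα P) hsub hlim hx
      hbar⟩
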